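/- **Conventions.** A *graph* $\Gamma$ has a set of vertices $V\Gamma$, a set of arcs $A\Gamma$, origin and terminus maps $o,t\colon A\Gamma\to V\Gamma$ and a reversal map $a\mapsto\bar a$ on $A\Gamma$ with $\bar{\bar a}=a$ and $o(a)=t(\bar a)$; loops, multiple arcs and *self-reverse* arcs ($\bar a=a$) are allowed. Graph morphisms and isomorphisms are pairs of maps (bijections) on vertices and arcs that commute with $o$, $t$ and reversal. Connected graphs are non-empty. A *tree* is a connected graph without loops and without simple cycles of length $\ge 3$ in which an arc is determined by its origin and terminus; a *subtree* is a subgraph that is a tree. A *permutation group* $(G,X)$ consists of a non-empty set $X$ and a subgroup $G\le \mathrm{Sym}(X)$. An *embedding* $\Phi\colon (H,Y)\hookrightarrow(G,X)$ is an injection $\Phi\colon Y\to X$ such that for every $h\in H$ there is $g\in G$ with $g\Phi=\Phi h$ and, conversely, for every $g\in G$ with $g(\Phi(Y))=\Phi(Y)$ there is $h\in H$ with $g\Phi=\Phi h$. A *graph of group actions* $\mathcal G$ consists of a connected graph $\Delta$; a permutation group $(G(v),X(v))$ for every $v\in V\Delta$; a permutation group $(H(a),Y(a))$ for every $a\in A\Delta$,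 with $(H(\bar a),Y(\bar a))=(H(a),Y(a))$; an embedding $\Phi_a\colon(H(a),Y(a))\hookrightarrow(G(t(a)),X(t(a)))$ for every $a\in A\Delta$; and, for every self-reverse arc $a$, a permutation $h_a$ of $Y(a)$ with $h_aH(a)h_a^{-1}=H(a)$ and $h_a^2\in H(a)$. An *$a$-adhesion map* is a map $\gamma\Phi_a$ with $\gamma\in G(t(a))$; an *$a$-adhesion set* is the image of an $a$-adhesion map; if $a$ is self-reverse, a *twisted $a$-adhesion map* is a map $\gamma\Phi_ah_a$ with $\gamma\in G(t(a))$. A *scaffolding* $(\Sigma,\sim,\pi,p)$ for $\mathcal G$ consists of a graph $\Sigma$, an equivalence relation $\sim$ on $V\Sigma$, extended to $A\Sigma$ by $a\sim b\iff o(a)\sim o(b)$ and $t(a)\sim t(b)$, a graph morphism $\pi\colon T_\Sigma\to\Delta$ on the quotient graph $T_\Sigma=\Sigma/{\sim}$, and a map $p$ on $V\Sigma\cup A\Sigma$ such that the following hold, where $[x]$ is the class of $x$ as a subset of $\Sigma$ and $\llbracket x\rrbracket$ is the same class as a vertex or arc of $T_\Sigma$. 1. $T_\Sigma$ is a tree,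 and no arc of $\Sigma$ joins two equivalent vertices. 2. $p$ restricts to bijections $[v]\to X(\pi\llbracket v\rrbracket)$ for $v\in V\Sigma$ and $[a]\to Y(\pi\llbracket a\rrbracket)$ for $a\in A\Sigma$, and $p(\bar b)=p(b)$ for every arc $b$. 3. For $a\in A\Sigma$ let $\Psi_{\llbracket a\rrbracket}\colon Y(\pi\llbracket a\rrbracket)\to X(\pi(t\llbracket a\rrbracket))$ be the map with $\Psi_{\llbracket a\rrbracket}(p(b))=p(t(b))$ for all $b\in[a]$. If $\pi\llbracket a\rrbracket$ is not self-reverse, $\Psi_{\llbracket a\rrbracket}$ is a $\pi\llbracket a\rrbracket$-adhesion map. If $\pi\llbracket a\rrbracket$ is self-reverse, one of $\Psi_{\llbracket a\rrbracket},\Psi_{\llbracket \bar a\rrbracket}$ is a $\pi\llbracket a\rrbracket$-adhesion map and the other is a twisted $\pi\llbracket a\rrbracket$-adhesion map. 4. For every vertex $\llbracket v\rrbracket$ of $T_\Sigma$, every arc $b$ of $\Delta$ with $t(b)=\pi\llbracket v\rrbracket$ and every $b$-adhesion set $B$ there is exactly one arc $\llbracket a\rrbracket$ of $T_\Sigma$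 with $\pi\llbracket a\rrbracket=b$, $t\llbracket a\rrbracket=\llbracket v\rrbracket$ and $\Psi_{\llbracket a\rrbracket}(p([a]))=B$. For a subtree $S$ of $T_\Sigma$, let $\Sigma_S$ be the subgraph of $\Sigma$ spanned by $\bigcup_{\llbracket v\rrbracket\in VS}[v]$. Let $(\Sigma,\sim,\pi,p)$ and $(\Sigma',\sim',\pi',p')$ be scaffoldings for the same $\mathcal G$. A *scaffolding isomorphism* $\Sigma\to\Sigma'$ (a *partial scaffolding isomorphism* $\Sigma_S\to\Sigma'_{S'}$, for subtrees $S$ of $T_\Sigma$ and $S'$ of $T_{\Sigma'}$) is a graph isomorphism $f$ between these graphs such that $x\sim y\iff f(x)\sim' f(y)$ for any two vertices and any two arcs $x,y$, and $\pi\llbracket x\rrbracket=\pi'\llbracket f(x)\rrbracket$ for all vertices and arcs $x$ of its domain. Its *local map* at a vertex $\llbracket v\rrbracket$ of $T_\Sigma$ (respectively of $S$) is the permutation $f_{\llbracket v\rrbracket}$ of $X(\pi\llbracket v\rrbracket)$ with $f_{\llbracket v\rrbracket}(p(x))=p'(f(x))$ for all $x\in[v]$. It is *acceptable* if $f_{\llbracket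 v\rrbracket}\in G(\pi\llbracket v\rrbracket)$ for all these $\llbracket v\rrbracket$. A scaffolding isomorphism $f$ induces $\tilde f\colon VT_\Sigma\to VT_{\Sigma'}$, $\llbracket v\rrbracket\mapsto\llbracket f(v)\rrbracket$. **Theorem.** Let $(\Sigma,\sim,\pi,p)$ and $(\Sigma',\sim',\pi',p')$ be scaffoldings for a graph of group actions $\mathcal G$, self-reverse arcs allowed. (a) If $S_0$ and $S_0'$ are subtrees of $T_\Sigma$ and $T_{\Sigma'}$, then every acceptable partial scaffolding isomorphism $f\colon\Sigma_{S_0}\to\Sigma'_{S_0'}$ extends to an acceptable scaffolding isomorphism $F\colon\Sigma\to\Sigma'$. (b) If $\llbracket v\rrbracket\in VT_\Sigma$ and $\llbracket v'\rrbracket\in VT_{\Sigma'}$ satisfy $\pi\llbracket v\rrbracket=\pi'\llbracket v'\rrbracket$ and $f_0\in G(\pi\llbracket v\rrbracket)$, then there is an acceptable scaffolding isomorphism $f\colon\Sigma\to\Sigma'$ with $\tilde f(\llbracket v\rrbracket)=\llbracket v'\rrbracket$ and $f_{\llbracket v\rrbracket}=f_0$. (c) There is an acceptable scaffolding isomorphism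 $\Sigma\to\Sigma'$. -/

import Mathlib

namespace GGA

/-! ## Graphs -/

/-- A graph with vertex set `V` and arc set `A`: every arc has an origin, a terminus and a reverse.
Loops, multiple arcs and self-reverse arcs (`rev a = a`) are allowed. -/
structure SerreGraph (V : Type*) (A : Type*) where
  o : A → V
  t : A → V
  rev : A → A
  rev_rev : ∀ a, rev (rev a) = a
  o_eq_t_rev : ∀ a, o a = t (rev a)

namespace SerreGraph

variable {V A V' A' : Type*}

/-- The underlying simple graph: distinct vertices are adjacent iff some arc joins them. -/
def underlying (Γ : SerreGraph V A) : SimpleGraph V where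
  Adj u v := u ≠ v ∧ ∃ a, (Γ.o a = u ∧ Γ.t a = v) ∨ (Γ.o a = v ∧ Γ.t a = u)
  symm := ⟨fun _ _ h => ⟨h.1.symm, h.2.imp fun _ ha => ha.symm⟩⟩
  loopless := ⟨fun _ h => h.1 rfl⟩

/-- Connectedness (connected graphs are non-empty). -/
def Connected (Γ : SerreGraph V A) : Prop := Γ.underlying.Connected

/-- A graph is simple if it has no loops and arcs are determined by origin and terminus. -/
def IsSimple (Γ : SerreGraph V A) : Prop :=
  (∀ a, Γ.o a ≠ Γ.t a) ∧ ∀ a b, Γ.o a = Γ.o b → Γ.t a = Γ.t b → a = b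

/-- A tree is a simple connected (non-empty) graph without simple cycles of length at least `3`. -/
def IsTree (Γ : SerreGraph V A) : Prop :=
  Γ.IsSimple ∧ Γ.Connected ∧ Γ.underlying.IsAcyclic

/-- Graph morphisms. -/
structure Hom (Γ : SerreGraph V A) (Γ' : SerreGraph V' A') where
  onV : V → V'
  onA : A → A'
  map_o : ∀ a, onV (Γ.o a) = Γ'.o (onA a)
  map_t : ∀ a, onV (Γ.t a) = Γ'.t (onA a)
  map_rev : ∀ a, onA (Γ.rev a) = Γ'.rev (onA a)

/-- Graph isomorphisms: morphisms that are bijective on vertices and on arcs. -/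
structure Iso (Γ : SerreGraph V A) (Γ' : SerreGraph V' A') where
  onV : V ≃ V'
  onA : A ≃ A'
  map_o : ∀ a, onV (Γ.o a) = Γ'.o (onA a)
  map_t : ∀ a, onV (Γ.t a) = Γ'.t (onA a)
  map_rev : ∀ a, onA (Γ.rev a) = Γ'.rev (onA a)

/-- Subgraphs. -/
structure Subgraph (Γ : SerreGraph V A) where
  verts : Set V
  arcs : Set A
  o_mem : ∀ a ∈ arcs, Γ.o a ∈ verts
  t_mem : ∀ a ∈ arcs, Γ.t a ∈ verts
  rev_mem : ∀ a ∈ arcs, Γ.rev a ∈ arcs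

/-- A subgraph as a graph in its own right. -/
def Subgraph.coe {Γ : SerreGraph V A} (S : Γ.Subgraph) : SerreGraph S.verts S.arcs where
  o a := ⟨Γ.o a, S.o_mem a a.2⟩
  t a := ⟨Γ.t a, S.t_mem a a.2⟩
  rev a := ⟨Γ.rev a, S.rev_mem a a.2⟩
  rev_rev a := Subtype.ext (Γ.rev_rev a)
  o_eq_t_rev a := Subtype.ext (Γ.o_eq_t_rev a)

/-- A subtree is a subgraph that is a tree. -/
def Subgraph.IsSubtree {Γ : SerreGraph V A} (S : Γ.Subgraph) : Prop := S.coe.IsTree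

theorem t_eq_o_rev (Γ : SerreGraph V A) (a : A) : Γ.t a = Γ.o (Γ.rev a) := by
  rw [Γ.o_eq_t_rev, Γ.rev_rev]

/-- The subgraph spanned by a set of vertices. -/
def induce (Γ : SerreGraph V A) (W : Set V) : Γ.Subgraph where
  verts := W
  arcs := {a | Γ.o a ∈ W ∧ Γ.t a ∈ W}
  o_mem _ h := h.1
  t_mem _ h := h.2
  rev_mem a h := by
    refine ⟨?_, ?_⟩
    · rw [← Γ.t_eq_o_rev]; exact h.2
    · rw [← Γ.o_eq_t_rev]; exact h.1

/-- The extension to arcs of an equivalence relation on vertices: two arcs are equivalent iff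
their origins are equivalent and their termini are equivalent. -/
def arcRel (Γ : SerreGraph V A) (r : Setoid V) : Setoid A where
  r a b := r (Γ.o a) (Γ.o b) ∧ r (Γ.t a) (Γ.t b)
  iseqv :=
    ⟨fun _ => ⟨r.refl _, r.refl _⟩,
     fun h => ⟨r.symm h.1, r.symm h.2⟩,
     fun h h' => ⟨r.trans h.1 h'.1, r.trans h.2 h'.2⟩⟩

/-- The quotient graph by an equivalence relation on the vertices, extended to the arcs. -/
def quotient (Γ : SerreGraph V A) (r : Setoid V) :
    SerreGraph (Quotient r) (Quotient (Γ.arcRel r)) where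
  o := Quotient.lift (fun a => Quotient.mk r (Γ.o a)) fun _ _ h => Quotient.sound h.1
  t := Quotient.lift (fun a => Quotient.mk r (Γ.t a)) fun _ _ h => Quotient.sound h.2
  rev := Quotient.lift (fun a => Quotient.mk (Γ.arcRel r) (Γ.rev a)) fun a b h =>
    Quotient.sound (by
      refine ⟨?_, ?_⟩
      · rw [← Γ.t_eq_o_rev, ← Γ.t_eq_o_rev]; exact h.2
      · rw [← Γ.o_eq_t_rev, ← Γ.o_eq_t_rev]; exact h.1)
  rev_rev a := by
    induction a using Quotient.inductionOn with
    | h a => exact congrArg (Quotient.mk (Γ.arcRel r)) (Γ.rev_rev a)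
  o_eq_t_rev a := by
    induction a using Quotient.inductionOn with
    | h a => exact congrArg (Quotient.mk r) (Γ.o_eq_t_rev a)

end SerreGraph

/-! ## Permutation groups and graphs of group actions -/

/-- A permutation group `(G, X)` on a non-empty set `X ⊆ α`. The symmetric group of `X` is
identified with the group of those permutations of `α` that fix every point outside `X`. -/
structure PermAction (α : Type*) where
  set : Set α
  nonempty : set.Nonempty
  group : Subgroup (Equiv.Perm α)
  fixes_compl : ∀ g ∈ group, ∀ x ∉ set, g x = x

/-- `Φ` (of which only the values on `Y` matter) is an embedding of the permutation group `(H, Y)`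
into `(G, X)`: it is injective from `Y` to `X`, and it identifies `H` with the permutation group
induced on `Φ(Y)` by the setwise stabiliser of `Φ(Y)` in `G`. -/
structure IsActionEmbedding {α β : Type*} (HY : PermAction β) (GX : PermAction α)
    (Φ : β → α) : Prop where
  mapsTo : Set.MapsTo Φ HY.set GX.set
  injOn : Set.InjOn Φ HY.set
  exists_of_mem : ∀ h ∈ HY.group, ∃ g ∈ GX.group, ∀ y ∈ HY.set, g (Φ y) = Φ (h y)
  exists_of_stabilises : ∀ g ∈ GX.group, g '' (Φ '' HY.set) = Φ '' HY.set →
    ∃ h ∈ HY.group, ∀ y ∈ HY.set, g (Φ y) = Φ (h y)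

/-- A graph of group actions; self-reverse arcs in the base graph are allowed. The sets `X(v)` are
subsets of a common type `𝒳`, the sets `Y(a)` subsets of a common type `𝒴`. -/
structure GraphOfGroupActions (VΔ AΔ 𝒳 𝒴 : Type*) where
  /-- the base graph `Δ` -/
  base : SerreGraph VΔ AΔ
  connected : base.Connected
  /-- the action `(G(v), X(v))` at the vertex `v` -/
  vertexAction : VΔ → PermAction 𝒳
  /-- the action `(H(a), Y(a))` at the arc `a` -/
  arcAction : AΔ → PermAction 𝒴
  arcAction_rev : ∀ a, arcAction (base.rev a) = arcAction a
  /-- the embeddings `Φ_a : Y(a) → X(t(a))` -/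
  Φ : AΔ → 𝒴 → 𝒳
  embedding : ∀ a, IsActionEmbedding (arcAction a) (vertexAction (base.t a)) (Φ a)
  /-- the inversion agents `h_a`; only the values at self-reverse arcs are ever used -/
  agent : AΔ → Equiv.Perm 𝒴
  agent_fixes_compl : ∀ a, base.rev a = a → ∀ y ∉ (arcAction a).set, agent a y = y
  agent_conj : ∀ a, base.rev a = a →
    (arcAction a).group.map (MulAut.conj (agent a)).toMonoidHom = (arcAction a).group
  agent_sq : ∀ a, base.rev a = a → agent a ^ 2 ∈ (arcAction a).group

namespace GraphOfGroupActions

variable {VΔ AΔ 𝒳 𝒴 : Type*} (𝒢 : GraphOfGroupActions VΔ AΔ 𝒳 𝒴)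

/-- The set `X(v)`. -/
abbrev X (v : VΔ) : Set 𝒳 := (𝒢.vertexAction v).set

/-- The permutation group `G(v)` on `X(v)`. -/
abbrev G (v : VΔ) : Subgroup (Equiv.Perm 𝒳) := (𝒢.vertexAction v).group

/-- The set `Y(a)`. -/
abbrev Y (a : AΔ) : Set 𝒴 := (𝒢.arcAction a).set

/-- `Ψ` restricts to an `a`-adhesion map on `Y(a)`. -/
def IsAdhesionMap (a : AΔ) (Ψ : 𝒴 → 𝒳) : Prop :=
  ∃ γ ∈ 𝒢.G (𝒢.base.t a), ∀ y ∈ 𝒢.Y a, Ψ y = γ (𝒢.Φ a y)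

/-- `Ψ` restricts to a twisted `a`-adhesion map on `Y(a)` (for a self-reverse arc `a`). -/
def IsTwistedAdhesionMap (a : AΔ) (Ψ : 𝒴 → 𝒳) : Prop :=
  ∃ γ ∈ 𝒢.G (𝒢.base.t a), ∀ y ∈ 𝒢.Y a, Ψ y = γ (𝒢.Φ a (𝒢.agent a y))

/-- The `a`-adhesion sets are the translates of `Φ_a(Y(a))` under `G(t(a))`. -/
def IsAdhesionSet (a : AΔ) (B : Set 𝒳) : Prop :=
  ∃ γ ∈ 𝒢.G (𝒢.base.t a), B = γ '' (𝒢.Φ a '' 𝒢.Y a)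

end GraphOfGroupActions

/-! ## Scaffoldings -/

section Scaffolding

variable {VΔ AΔ 𝒳 𝒴 : Type*}

/-- A scaffolding `(Σ, ∼, π, p)` for a graph of group actions, where `Σ` has vertex set `V` and arc
set `A`. -/
structure Scaffolding (𝒢 : GraphOfGroupActions VΔ AΔ 𝒳 𝒴) (V A : Type*) where
  /-- the graph `Σ` -/
  graph : SerreGraph V A
  /-- the equivalence relation `∼` on the vertices -/
  rel : Setoid V
  /-- the quotient graph is a tree -/
  isTree : (graph.quotient rel).IsTree
  /-- vertex bundles induce graphs without arcs -/
  bundle_empty : ∀ a, ¬ rel (graph.o a) (graph.t a)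
  /-- the graph morphism `π` from the quotient graph to the base graph -/
  π : (graph.quotient rel).Hom 𝒢.base
  /-- the legal colouring `p` on vertices -/
  pV : V → 𝒳
  /-- the legal colouring `p` on arcs -/
  pA : A → 𝒴
  pV_bij : ∀ u : Quotient rel, Set.BijOn pV {x | Quotient.mk rel x = u} (𝒢.X (π.onV u))
  pA_bij : ∀ e : Quotient (graph.arcRel rel),
    Set.BijOn pA {a | Quotient.mk (graph.arcRel rel) a = e} (𝒢.Y (π.onA e))
  pA_rev : ∀ a, pA (graph.rev a) = pA a
  /-- over an arc that is not self-reverse, the map `Ψ` given by `Ψ p(b) = p t(b)` on the arc bundle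
  is an adhesion map -/
  adhesion : ∀ e : Quotient (graph.arcRel rel),
    𝒢.base.rev (π.onA e) ≠ π.onA e →
    ∃ Ψ : 𝒴 → 𝒳, (∀ b, Quotient.mk (graph.arcRel rel) b = e → Ψ (pA b) = pV (graph.t b)) ∧
      𝒢.IsAdhesionMap (π.onA e) Ψ
  /-- over a self-reverse arc, one of the maps `Ψ` for an arc bundle and for the reverse arc bundle
  is an adhesion map and the other one is a twisted adhesion map -/
  adhesion_selfRev : ∀ e : Quotient (graph.arcRel rel),
    𝒢.base.rev (π.onA e) = π.onA e →
    ∃ Ψ Ψ' : 𝒴 → 𝒳,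
      (∀ b, Quotient.mk (graph.arcRel rel) b = e → Ψ (pA b) = pV (graph.t b)) ∧
      (∀ b, Quotient.mk (graph.arcRel rel) b = (graph.quotient rel).rev e →
        Ψ' (pA b) = pV (graph.t b)) ∧
      ((𝒢.IsAdhesionMap (π.onA e) Ψ ∧ 𝒢.IsTwistedAdhesionMap (π.onA e) Ψ') ∨
        (𝒢.IsTwistedAdhesionMap (π.onA e) Ψ ∧ 𝒢.IsAdhesionMap (π.onA e) Ψ'))
  /-- every adhesion set belongs to exactly one arc bundle -/
  existsUnique_arc : ∀ (u : Quotient rel) (b : AΔ), 𝒢.base.t b = π.onV u →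
    ∀ B : Set 𝒳, 𝒢.IsAdhesionSet b B →
      ∃! e : Quotient (graph.arcRel rel), π.onA e = b ∧ (graph.quotient rel).t e = u ∧
        (fun a => pV (graph.t a)) '' {a | Quotient.mk (graph.arcRel rel) a = e} = B

namespace Scaffolding

variable {𝒢 : GraphOfGroupActions VΔ AΔ 𝒳 𝒴} {V A V' A' : Type*}

/-- The tree `T_Σ`, the quotient graph of `Σ` by `∼`. -/
abbrev tree (S : Scaffolding 𝒢 V A) :
    SerreGraph (Quotient S.rel) (Quotient (S.graph.arcRel S.rel)) :=
  S.graph.quotient S.rel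

/-- The vertex `⟦x⟧` of `T_Σ`. -/
abbrev bunV (S : Scaffolding 𝒢 V A) (x : V) : Quotient S.rel := Quotient.mk S.rel x

/-- The arc `⟦a⟧` of `T_Σ`. -/
abbrev bunA (S : Scaffolding 𝒢 V A) (a : A) : Quotient (S.graph.arcRel S.rel) :=
  Quotient.mk (S.graph.arcRel S.rel) a

/-- The part `Σ_R` of `Σ` over a subgraph `R` of `T_Σ`: the subgraph of `Σ` spanned by the union of
the vertex bundles `[v]` with `⟦v⟧` in `R`. -/
def part (S : Scaffolding 𝒢 V A) (R : S.tree.Subgraph) : S.graph.Subgraph :=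
  S.graph.induce {x | S.bunV x ∈ R.verts}

/-- Scaffolding isomorphisms: graph isomorphisms `f : Σ → Σ'` with `x ∼ y ↔ f(x) ∼' f(y)` and
`π⟦x⟧ = π'⟦f(x)⟧`, for vertices and for arcs. -/
structure ScIso (S : Scaffolding 𝒢 V A) (S' : Scaffolding 𝒢 V' A') extends
    SerreGraph.Iso S.graph S'.graph where
  relV_iff : ∀ x y, S.rel x y ↔ S'.rel (onV x) (onV y)
  relA_iff : ∀ a b, S.graph.arcRel S.rel a b ↔ S'.graph.arcRel S'.rel (onA a) (onA b)
  π_onV : ∀ x, S.π.onV (S.bunV x) = S'.π.onV (S'.bunV (onV x))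
  π_onA : ∀ a, S.π.onA (S.bunA a) = S'.π.onA (S'.bunA (onA a))

/-- The map induced by a scaffolding isomorphism on the vertices of `T_Σ`. -/
def ScIso.tilde {S : Scaffolding 𝒢 V A} {S' : Scaffolding 𝒢 V' A'} (f : ScIso S S') :
    Quotient S.rel → Quotient S'.rel :=
  Quotient.map f.onV fun x y h => (f.relV_iff x y).1 h

/-- The permutation `σ` of `X(π(u))` is the local map of `f` at the vertex `u` of `T_Σ`, that is
`σ(p(x)) = p'(f(x))` for every `x` in the bundle of `u`. It is unique. -/
def ScIso.IsLocalMap {S : Scaffolding 𝒢 V A} {S' : Scaffolding 𝒢 V' A'} (f : ScIso S S')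
    (u : Quotient S.rel) (σ : Equiv.Perm 𝒳) : Prop :=
  (∀ z ∉ 𝒢.X (S.π.onV u), σ z = z) ∧
    ∀ x, S.bunV x = u → σ (S.pV x) = S'.pV (f.onV x)

/-- A scaffolding isomorphism is acceptable if all its local maps lie in the vertex groups. -/
def ScIso.Acceptable {S : Scaffolding 𝒢 V A} {S' : Scaffolding 𝒢 V' A'} (f : ScIso S S') : Prop :=
  ∀ u : Quotient S.rel, ∃ σ ∈ 𝒢.G (S.π.onV u), f.IsLocalMap u σ

/-- Partial scaffolding isomorphisms `Σ_R → Σ'_R'`. -/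
structure PartialScIso (S : Scaffolding 𝒢 V A) (S' : Scaffolding 𝒢 V' A')
    (R : S.tree.Subgraph) (R' : S'.tree.Subgraph) extends
    SerreGraph.Iso (S.part R).coe (S'.part R').coe where
  relV_iff : ∀ x y : (S.part R).verts, S.rel x y ↔ S'.rel (onV x) (onV y)
  relA_iff : ∀ a b : (S.part R).arcs,
    S.graph.arcRel S.rel a b ↔ S'.graph.arcRel S'.rel (onA a) (onA b)
  π_onV : ∀ x : (S.part R).verts, S.π.onV (S.bunV x) = S'.π.onV (S'.bunV (onV x))
  π_onA : ∀ a : (S.part R).arcs, S.π.onA (S.bunA a) = S'.π.onA (S'.bunA (onA a))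

/-- The permutation `σ` of `X(π(u))` is the local map of the partial scaffolding isomorphism `f` at
the vertex `u` of `R`. -/
def PartialScIso.IsLocalMap {S : Scaffolding 𝒢 V A} {S' : Scaffolding 𝒢 V' A'}
    {R : S.tree.Subgraph} {R' : S'.tree.Subgraph} (f : PartialScIso S S' R R')
    (u : Quotient S.rel) (σ : Equiv.Perm 𝒳) : Prop :=
  (∀ z ∉ 𝒢.X (S.π.onV u), σ z = z) ∧
    ∀ x : (S.part R).verts, S.bunV x = u → σ (S.pV x) = S'.pV (f.onV x)

/-- A partial scaffolding isomorphism defined over `R` is acceptable if its local map at every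
vertex of `R` lies in the vertex group. -/
def PartialScIso.Acceptable {S : Scaffolding 𝒢 V A} {S' : Scaffolding 𝒢 V' A'}
    {R : S.tree.Subgraph} {R' : S'.tree.Subgraph} (f : PartialScIso S S' R R') : Prop :=
  ∀ u ∈ R.verts, ∃ σ ∈ 𝒢.G (S.π.onV u), f.IsLocalMap u σ

/-- `F` extends the partial scaffolding isomorphism `f`, on vertices and on arcs. -/
def ScIso.Extends {S : Scaffolding 𝒢 V A} {S' : Scaffolding 𝒢 V' A'}
    {R : S.tree.Subgraph} {R' : S'.tree.Subgraph} (F : ScIso S S')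
    (f : PartialScIso S S' R R') : Prop :=
  (∀ x : (S.part R).verts, F.onV x = f.onV x) ∧ ∀ a : (S.part R).arcs, F.onA a = f.onA a

end Scaffolding

end Scaffolding

end GGA

namespace GGA

variable {VΔ AΔ 𝒳 𝒴 V A V' A' : Type*}

/-! ## Permutation groups and adhesion maps -/

/-! A local map in `G` at a vertex of `T_Σ` permutes the adhesion sets there, so condition 4 pairs
the arcs at this vertex with the arcs at its image. For two paired arcs over `a`, the resulting
matching of colours is, up to twists, an element of `H(a)`. Since `H(a)` is induced from the vertex
groups at both ends of `a`, the matching is induced by a group element at the other end as well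
(`exists_transport`, `exists_matched`). If `a` is self-reverse, the two bundles may be twisted at
different ends; the element of `H(a)` is then conjugated by `h_a` or its inverse, up to a factor
`h_a ^ 2` or its inverse, and so stays in `H(a)` (`IsTwistPair.conj_mem`).

Local maps therefore propagate across arcs, and in a tree no two propagations can conflict: Zorn's
lemma extends any coherent family on a geodesically closed set of vertices to all of `T_Σ`
(`IsPartialLift.exists_isLift`). The resulting vertex map of trees is locally bijective by condition
4, hence bijective because both quotients are trees. A vertex of a scaffolding is determined by its
class and colour, and an arc by its ends, so the family of local maps is realised by a scaffolding
isomorphism (`IsLift.exists_scIso`). Part (a) starts from the local maps of `f`, part (b) from a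
single vertex, and part (c) from the identity at a vertex, using that `π'` is surjective on
vertices. -/

theorem apply_mem_iff_of_fixes_compl {α : Type*} {s : Set α} {g : Equiv.Perm α}
    (h : ∀ x ∉ s, g x = x) (x : α) : g x ∈ s ↔ x ∈ s := by
  refine ⟨fun hx => ?_, fun hx => ?_⟩
  · by_contra hn
    exact hn (h x hn ▸ hx)
  · by_contra hn
    exact hn ((g.injective (h _ hn)).symm ▸ hx)

theorem PermAction.apply_mem_iff {α : Type*} (P : PermAction α) {g : Equiv.Perm α}
    (hg : g ∈ P.group) (x : α) : g x ∈ P.set ↔ x ∈ P.set :=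
  apply_mem_iff_of_fixes_compl (P.fixes_compl g hg) x

namespace GraphOfGroupActions

variable (𝒢 : GraphOfGroupActions VΔ AΔ 𝒳 𝒴)

/-- The twists that may occur at the two ends of an arc bundle over `a`. -/
def IsTwistPair (a : AΔ) (k l : Equiv.Perm 𝒴) : Prop :=
  (𝒢.base.rev a ≠ a ∧ k = 1 ∧ l = 1) ∨
    (𝒢.base.rev a = a ∧ ((k = 1 ∧ l = 𝒢.agent a) ∨ (k = 𝒢.agent a ∧ l = 1)))

/-- `Ψ` and `Ψr` are the maps into the terminal and the initial vertex of an arc bundle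
over `a`. -/
def IsAdhesionPair (a : AΔ) (Ψ Ψr : 𝒴 → 𝒳) : Prop :=
  ∃ γ ∈ 𝒢.G (𝒢.base.t a), ∃ δ ∈ 𝒢.G (𝒢.base.t (𝒢.base.rev a)), ∃ k l, 𝒢.IsTwistPair a k l ∧
    (∀ y ∈ 𝒢.Y a, Ψ y = γ (𝒢.Φ a (k y))) ∧
    (∀ y ∈ 𝒢.Y a, Ψr y = δ (𝒢.Φ (𝒢.base.rev a) (l y)))

variable {𝒢}

theorem agent_mul_mul_inv_mem {a : AΔ} (ha : 𝒢.base.rev a = a) {h : Equiv.Perm 𝒴}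
    (hh : h ∈ (𝒢.arcAction a).group) :
    𝒢.agent a * h * (𝒢.agent a)⁻¹ ∈ (𝒢.arcAction a).group := by
  rw [← 𝒢.agent_conj a ha]
  exact ⟨h, hh, rfl⟩

theorem agent_inv_mul_mul_mem {a : AΔ} (ha : 𝒢.base.rev a = a) {h : Equiv.Perm 𝒴}
    (hh : h ∈ (𝒢.arcAction a).group) :
    (𝒢.agent a)⁻¹ * h * 𝒢.agent a ∈ (𝒢.arcAction a).group := by
  rw [← 𝒢.agent_conj a ha] at hh
  obtain ⟨g, hg, rfl⟩ := hh
  simpa [mul_assoc] using hg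

theorem agent_mem_iff {a : AΔ} (ha : 𝒢.base.rev a = a) (y : 𝒴) :
    𝒢.agent a y ∈ 𝒢.Y a ↔ y ∈ 𝒢.Y a :=
  apply_mem_iff_of_fixes_compl (𝒢.agent_fixes_compl a ha) y

theorem IsTwistPair.mem_iff {a : AΔ} {k l : Equiv.Perm 𝒴} (h : 𝒢.IsTwistPair a k l) (y : 𝒴) :
    (k y ∈ 𝒢.Y a ↔ y ∈ 𝒢.Y a) ∧ (l y ∈ 𝒢.Y a ↔ y ∈ 𝒢.Y a) := by
  rcases h with ⟨-, rfl, rfl⟩ | ⟨ha, ⟨rfl, rfl⟩ | ⟨rfl, rfl⟩⟩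
  · simp
  · simpa using agent_mem_iff ha y
  · simpa using agent_mem_iff ha y

/-- This is where the axioms on inversion agents enter. With `s` the agent, twists at the same end
give `s * h * s⁻¹` or `s⁻¹ * h * s`; twists at different ends give `s * h * s` or `s⁻¹ * h * s⁻¹`,
which differ from `s * h * s⁻¹` by a factor `s ^ 2` or its inverse. -/
theorem IsTwistPair.conj_mem {a : AΔ} {k l k' l' h : Equiv.Perm 𝒴} (hkl : 𝒢.IsTwistPair a k l)
    (hkl' : 𝒢.IsTwistPair a k' l') (hh : h ∈ (𝒢.arcAction a).group) :
    l' * (k'⁻¹ * h * k) * l⁻¹ ∈ (𝒢.arcAction a).group := by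
  rcases hkl with ⟨hn, rfl, rfl⟩ | ⟨ha, hkl⟩
  · rcases hkl' with ⟨-, rfl, rfl⟩ | ⟨ha, -⟩
    · simpa using hh
    · exact absurd ha hn
  · rcases hkl' with ⟨hn, -⟩ | ⟨-, hkl'⟩
    · exact absurd ha hn
    have hsq := 𝒢.agent_sq a ha
    have h1 := agent_mul_mul_inv_mem ha hh
    have h2 := agent_inv_mul_mul_mem ha hh
    rcases hkl with ⟨rfl, rfl⟩ | ⟨rfl, rfl⟩ <;> rcases hkl' with ⟨rfl, rfl⟩ | ⟨rfl, rfl⟩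
    · simpa using h1
    · have := mul_mem (inv_mem hsq) h1
      simpa [pow_two, mul_assoc] using this
    · have := mul_mem h1 hsq
      simpa [pow_two, mul_assoc] using this
    · simpa using h2

theorem image_Y_eq {a : AΔ} {k : Equiv.Perm 𝒴} (hk : ∀ y, k y ∈ 𝒢.Y a ↔ y ∈ 𝒢.Y a) :
    k '' 𝒢.Y a = 𝒢.Y a := by
  ext y
  constructor
  · rintro ⟨z, hz, rfl⟩
    exact (hk z).2 hz
  · intro hy
    exact ⟨k.symm y, by rw [← hk]; simpa using hy, by simp⟩

/-- A twist only permutes `Y(a)`, so twisted adhesion maps have the same images as untwisted ones.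
-/
theorem image_adhesion_eq {a : AΔ} {k : Equiv.Perm 𝒴} (hk : ∀ y, k y ∈ 𝒢.Y a ↔ y ∈ 𝒢.Y a)
    {Ψ : 𝒴 → 𝒳} {γ : Equiv.Perm 𝒳} (hΨ : ∀ y ∈ 𝒢.Y a, Ψ y = γ (𝒢.Φ a (k y))) :
    Ψ '' 𝒢.Y a = γ '' (𝒢.Φ a '' 𝒢.Y a) := by
  conv_rhs => rw [← image_Y_eq hk]
  rw [Set.image_image, Set.image_image]
  exact Set.image_congr hΨ

/-- A group element carrying the image of one arc bundle to that of another induces a matching of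
the colours of the two bundles, which is induced by a group element at the other end. -/
theorem IsAdhesionPair.exists_transport {a : AΔ} {Ψ Ψr Ψ' Ψr' : 𝒴 → 𝒳}
    (hp : 𝒢.IsAdhesionPair a Ψ Ψr) (hp' : 𝒢.IsAdhesionPair a Ψ' Ψr') {σ : Equiv.Perm 𝒳}
    (hσ : σ ∈ 𝒢.G (𝒢.base.t a)) (him : σ '' (Ψ '' 𝒢.Y a) = Ψ' '' 𝒢.Y a) :
    ∃ m : Equiv.Perm 𝒴, (∀ y, m y ∈ 𝒢.Y a ↔ y ∈ 𝒢.Y a) ∧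
      ∃ τ ∈ 𝒢.G (𝒢.base.t (𝒢.base.rev a)),
        ∀ y ∈ 𝒢.Y a, Ψ' (m y) = σ (Ψ y) ∧ Ψr' (m y) = τ (Ψr y) := by
  obtain ⟨γ, hγ, δ, hδ, k, l, hkl, hΨ, hΨr⟩ := hp
  obtain ⟨γ', hγ', δ', hδ', k', l', hkl', hΨ', hΨr'⟩ := hp'
  rw [image_adhesion_eq (fun y => (hkl.mem_iff y).1) hΨ,
    image_adhesion_eq (fun y => (hkl'.mem_iff y).1) hΨ'] at him
  -- Undoing `γ` and `γ'` turns `σ` into an element stabilising `Φ_a(Y(a))`, which therefore acts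
  -- there as some `h` in `H(a)`.
  have hstab : (γ'⁻¹ * σ * γ) '' (𝒢.Φ a '' 𝒢.Y a) = 𝒢.Φ a '' 𝒢.Y a := by
    have := congrArg (fun s => (γ'⁻¹ : Equiv.Perm 𝒳) '' s) him
    simp only [Set.image_image] at this ⊢
    simpa using this
  obtain ⟨h, hh, hgh⟩ := (𝒢.embedding a).exists_of_stabilises _
    (mul_mem (mul_mem (inv_mem hγ') hσ) hγ) hstab
  have hY := congrArg PermAction.set (𝒢.arcAction_rev a)
  have hmem : ∀ y, (k'⁻¹ * h * k) y ∈ 𝒢.Y a ↔ y ∈ 𝒢.Y a := fun y => by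
    rw [← (hkl'.mem_iff _).1]
    simpa using ((𝒢.arcAction a).apply_mem_iff hh (k y)).trans (hkl.mem_iff y).1
  -- The matching of colours is `k'⁻¹ * h * k`. Read at the other end, through `l` and `l'`, it is
  -- still an element of `H(a)`, so it is induced by a group element there.
  obtain ⟨g, hg, hgl⟩ := (𝒢.embedding (𝒢.base.rev a)).exists_of_mem _
    ((𝒢.arcAction_rev a).symm ▸ hkl.conj_mem hkl' hh)
  refine ⟨k'⁻¹ * h * k, hmem, δ' * g * δ⁻¹, mul_mem (mul_mem hδ' hg) (inv_mem hδ), fun y hy => ?_⟩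
  constructor
  · rw [hΨ' _ ((hmem y).2 hy), hΨ y hy]
    have := hgh (k y) ((hkl.mem_iff y).1.2 hy)
    simp only [Equiv.Perm.mul_apply] at this ⊢
    simp [← this]
  · rw [hΨr' _ ((hmem y).2 hy), hΨr y hy]
    have := hgl (l y) (hY.symm ▸ (hkl.mem_iff y).2.2 hy)
    simp only [Equiv.Perm.mul_apply] at this ⊢
    simpa using this.symm

end GraphOfGroupActions

/-! ## Arc bundles of a scaffolding -/

namespace Scaffolding

open GraphOfGroupActions

variable {𝒢 : GraphOfGroupActions VΔ AΔ 𝒳 𝒴}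

section Bundles

variable (S : Scaffolding 𝒢 V A)

/-- The set of colours of the termini of the arcs in the bundle `e`. -/
def termImage (e : Quotient (S.graph.arcRel S.rel)) : Set 𝒳 :=
  (fun a => S.pV (S.graph.t a)) '' {a | S.bunA a = e}

/-- Puts the axioms for self-reverse and other arcs into one form. The map at the origin is the map
at the terminus of the reverse bundle, as `p` is invariant under reversal. -/
theorem exists_adhesionPair (e : Quotient (S.graph.arcRel S.rel)) :
    ∃ Ψ Ψr : 𝒴 → 𝒳, 𝒢.IsAdhesionPair (S.π.onA e) Ψ Ψr ∧
      (∀ b, S.bunA b = e → Ψ (S.pA b) = S.pV (S.graph.t b)) ∧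
      (∀ b, S.bunA b = e → Ψr (S.pA b) = S.pV (S.graph.o b)) := by
  have hrev : ∀ Ψ : 𝒴 → 𝒳,
      (∀ b, S.bunA b = S.tree.rev e → Ψ (S.pA b) = S.pV (S.graph.t b)) →
      ∀ b, S.bunA b = e → Ψ (S.pA b) = S.pV (S.graph.o b) := by
    rintro Ψ h b rfl
    rw [← S.pA_rev, S.graph.o_eq_t_rev]
    exact h _ rfl
  by_cases hs : 𝒢.base.rev (S.π.onA e) = S.π.onA e
  · obtain ⟨Ψ, Ψ', h, h', hc⟩ := S.adhesion_selfRev e hs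
    refine ⟨Ψ, Ψ', ?_, h, hrev _ h'⟩
    unfold IsAdhesionPair
    rw [hs]
    rcases hc with ⟨⟨γ, hγ, hΨ⟩, ⟨δ, hδ, hΨ'⟩⟩ | ⟨⟨γ, hγ, hΨ⟩, ⟨δ, hδ, hΨ'⟩⟩
    · exact ⟨γ, hγ, δ, hδ, 1, _, Or.inr ⟨hs, Or.inl ⟨rfl, rfl⟩⟩, hΨ, hΨ'⟩
    · exact ⟨γ, hγ, δ, hδ, _, 1, Or.inr ⟨hs, Or.inr ⟨rfl, rfl⟩⟩, hΨ, hΨ'⟩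
  · obtain ⟨Ψ, h, γ, hγ, hΨ⟩ := S.adhesion e hs
    have hs' : 𝒢.base.rev (S.π.onA (S.tree.rev e)) ≠ S.π.onA (S.tree.rev e) := by
      rw [S.π.map_rev, 𝒢.base.rev_rev]
      exact fun h => hs h.symm
    obtain ⟨Ψ', h', hΨ'⟩ := S.adhesion _ hs'
    rw [S.π.map_rev] at hΨ'
    obtain ⟨δ, hδ, hΨ'⟩ := hΨ'
    refine ⟨Ψ, Ψ', ⟨γ, hγ, δ, hδ, 1, 1, Or.inl ⟨hs, rfl, rfl⟩, hΨ, fun y hy => hΨ' y ?_⟩, h,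
      hrev _ h'⟩
    rwa [Y, 𝒢.arcAction_rev]

theorem termImage_eq {e : Quotient (S.graph.arcRel S.rel)} {Ψ : 𝒴 → 𝒳}
    (h : ∀ b, S.bunA b = e → Ψ (S.pA b) = S.pV (S.graph.t b)) :
    S.termImage e = Ψ '' 𝒢.Y (S.π.onA e) := by
  rw [← (S.pA_bij e).image_eq, Set.image_image]
  exact (Set.image_congr h).symm

theorem isAdhesionSet_termImage (e : Quotient (S.graph.arcRel S.rel)) :
    𝒢.IsAdhesionSet (S.π.onA e) (S.termImage e) := by
  obtain ⟨Ψ, Ψr, ⟨γ, hγ, -, -, k, l, hkl, hΨ, -⟩, h, -⟩ := S.exists_adhesionPair e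
  exact ⟨γ, hγ, (S.termImage_eq h).trans (image_adhesion_eq (fun y => (hkl.mem_iff y).1) hΨ)⟩

variable {S}

theorem arc_eq_of_termImage_eq {e e₂ : Quotient (S.graph.arcRel S.rel)}
    (ht : S.tree.t e = S.tree.t e₂) (hπ : S.π.onA e = S.π.onA e₂)
    (hB : S.termImage e = S.termImage e₂) : e = e₂ :=
  (S.existsUnique_arc (S.tree.t e) (S.π.onA e) (S.π.map_t e).symm _
    (S.isAdhesionSet_termImage e)).unique ⟨rfl, rfl, rfl⟩ ⟨hπ.symm, ht.symm, hB.symm⟩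

theorem vertex_ext {x y : V} (h : S.bunV x = S.bunV y) (hp : S.pV x = S.pV y) : x = y :=
  (S.pV_bij (S.bunV y)).injOn h rfl hp

theorem pV_mem (x : V) : S.pV x ∈ 𝒢.X (S.π.onV (S.bunV x)) :=
  (S.pV_bij (S.bunV x)).mapsTo rfl

/-- The graph of a scaffolding has no parallel arcs. -/
theorem arc_ext {a b : A} (ho : S.graph.o a = S.graph.o b) (ht : S.graph.t a = S.graph.t b) :
    a = b := by
  -- The tree has no parallel arcs, so both arcs lie in one bundle. There the colour of the terminus
  -- determines the colour of the arc, as adhesion maps are injective.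
  have hab : S.bunA a = S.bunA b :=
    S.isTree.1.2 _ _ (congrArg S.bunV ho) (congrArg S.bunV ht)
  obtain ⟨Ψ, Ψr, ⟨γ, -, -, -, k, l, hkl, hΨ, -⟩, h, -⟩ := S.exists_adhesionPair (S.bunA b)
  have hma := (S.pA_bij (S.bunA b)).mapsTo hab
  have hmb := (S.pA_bij (S.bunA b)).mapsTo (x := b) rfl
  refine (S.pA_bij (S.bunA b)).injOn hab rfl (k.injective ?_)
  refine (𝒢.embedding _).injOn ((hkl.mem_iff _).1.2 hma) ((hkl.mem_iff _).1.2 hmb)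
    (γ.injective ?_)
  rw [← hΨ _ hma, ← hΨ _ hmb, h _ hab, h _ rfl, ht]

theorem exists_arc_of_adj {u w : Quotient S.rel} (h : S.tree.underlying.Adj u w) :
    ∃ e, S.tree.o e = u ∧ S.tree.t e = w := by
  obtain ⟨-, a, h | ⟨ho, ht⟩⟩ := h
  · exact ⟨a, h⟩
  · exact ⟨S.tree.rev a, by rw [← S.tree.t_eq_o_rev, ht], by rw [← S.tree.o_eq_t_rev, ho]⟩

theorem adj_of_arc (e : Quotient (S.graph.arcRel S.rel)) :
    S.tree.underlying.Adj (S.tree.o e) (S.tree.t e) :=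
  ⟨S.isTree.1.1 e, e, Or.inl ⟨rfl, rfl⟩⟩

end Bundles

/-! ## Matched arc bundles -/

section Matched

variable (S : Scaffolding 𝒢 V A) (S' : Scaffolding 𝒢 V' A')

/-- The local maps `σ` and `τ` at the terminus and the origin of `e` and `e'` are induced by a
bijection between the arc bundles. -/
structure Matched (σ τ : Equiv.Perm 𝒳) (e : Quotient (S.graph.arcRel S.rel))
    (e' : Quotient (S'.graph.arcRel S'.rel)) : Prop where
  π_eq : S.π.onA e = S'.π.onA e'
  forth : ∀ b, S.bunA b = e → ∃ b', S'.bunA b' = e' ∧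
    S'.pV (S'.graph.t b') = σ (S.pV (S.graph.t b)) ∧
    S'.pV (S'.graph.o b') = τ (S.pV (S.graph.o b))
  back : ∀ b', S'.bunA b' = e' → ∃ b, S.bunA b = e ∧
    S'.pV (S'.graph.t b') = σ (S.pV (S.graph.t b)) ∧
    S'.pV (S'.graph.o b') = τ (S.pV (S.graph.o b))

variable {S S'}

theorem bunA_rev {b : A} {e : Quotient (S.graph.arcRel S.rel)} (h : S.bunA b = S.tree.rev e) :
    S.bunA (S.graph.rev b) = e := by
  rw [← S.tree.rev_rev e, ← h]
  rfl

theorem Matched.rev {σ τ : Equiv.Perm 𝒳} {e : Quotient (S.graph.arcRel S.rel)}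
    {e' : Quotient (S'.graph.arcRel S'.rel)} (h : Matched S S' σ τ e e') :
    Matched S S' τ σ (S.tree.rev e) (S'.tree.rev e') where
  π_eq := by rw [S.π.map_rev, S'.π.map_rev, h.π_eq]
  forth b hb := by
    obtain ⟨b', rfl, ht, ho⟩ := h.forth _ (bunA_rev hb)
    refine ⟨S'.graph.rev b', rfl, ?_, ?_⟩
    · rw [← S'.graph.o_eq_t_rev, ho, ← S.graph.t_eq_o_rev]
    · rw [← S'.graph.t_eq_o_rev, ht, ← S.graph.o_eq_t_rev]
  back b' hb := by
    obtain ⟨b, rfl, ht, ho⟩ := h.back _ (bunA_rev hb)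
    refine ⟨S.graph.rev b, rfl, ?_, ?_⟩
    · rw [← S.graph.o_eq_t_rev, ← ho, ← S'.graph.t_eq_o_rev]
    · rw [← S.graph.t_eq_o_rev, ← ht, ← S'.graph.o_eq_t_rev]

theorem Matched.termImage_eq {σ τ : Equiv.Perm 𝒳} {e : Quotient (S.graph.arcRel S.rel)}
    {e' : Quotient (S'.graph.arcRel S'.rel)} (h : Matched S S' σ τ e e') :
    S'.termImage e' = σ '' S.termImage e := by
  ext z
  constructor
  · rintro ⟨b', hb', rfl⟩
    obtain ⟨b, hb, ht, -⟩ := h.back b' hb'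
    exact ⟨_, ⟨b, hb, rfl⟩, ht.symm⟩
  · rintro ⟨_, ⟨b, hb, rfl⟩, rfl⟩
    obtain ⟨b', hb', ht, -⟩ := h.forth b hb
    exact ⟨b', hb', ht⟩

theorem isAdhesionSet_image {b : AΔ} {B : Set 𝒳} (h : 𝒢.IsAdhesionSet b B) {σ : Equiv.Perm 𝒳}
    (hσ : σ ∈ 𝒢.G (𝒢.base.t b)) : 𝒢.IsAdhesionSet b (σ '' B) := by
  obtain ⟨γ, hγ, rfl⟩ := h
  exact ⟨σ * γ, mul_mem hσ hγ, by rw [Equiv.Perm.coe_mul, Set.image_comp]⟩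

theorem exists_arc_termImage_eq {u : Quotient S.rel} {b : AΔ} (hu : 𝒢.base.t b = S.π.onV u)
    {B : Set 𝒳} (hB : 𝒢.IsAdhesionSet b B) :
    ∃ e, S.π.onA e = b ∧ S.tree.t e = u ∧ S.termImage e = B :=
  (S.existsUnique_arc u b hu B hB).exists

/-- A local map at the terminus of an arc of the tree extends to the origin. -/
theorem exists_matched (e : Quotient (S.graph.arcRel S.rel)) {u' : Quotient S'.rel}
    (hu' : S.π.onV (S.tree.t e) = S'.π.onV u') {σ : Equiv.Perm 𝒳}
    (hσ : σ ∈ 𝒢.G (S.π.onV (S.tree.t e))) :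
    ∃ e', S'.tree.t e' = u' ∧ ∃ τ ∈ 𝒢.G (S.π.onV (S.tree.o e)), Matched S S' σ τ e e' := by
  rw [S.π.map_t] at hσ hu'
  -- The partner of `e` is the arc at `u'` whose adhesion set is the `σ`-image of that of `e`.
  obtain ⟨e', hπ, ht, hB⟩ := exists_arc_termImage_eq hu'
    (isAdhesionSet_image (S.isAdhesionSet_termImage e) hσ)
  obtain ⟨Ψ, Ψr, hp, h, hr⟩ := S.exists_adhesionPair e
  obtain ⟨Ψ', Ψr', hp', h', hr'⟩ := S'.exists_adhesionPair e'
  have hY := S'.pA_bij e'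
  rw [S'.termImage_eq h', S.termImage_eq h, hπ] at hB
  rw [hπ] at hp' hY
  obtain ⟨m, hm, τ, hτ, hmτ⟩ := hp.exists_transport hp' hσ hB.symm
  rw [S.π.map_o, 𝒢.base.o_eq_t_rev]
  have key : ∀ b b', S.bunA b = e → S'.bunA b' = e' → S'.pA b' = m (S.pA b) →
      S'.pV (S'.graph.t b') = σ (S.pV (S.graph.t b)) ∧
      S'.pV (S'.graph.o b') = τ (S.pV (S.graph.o b)) := fun b b' hb hb' hbb' => by
    rw [← h b hb, ← hr b hb, ← h' b' hb', ← hr' b' hb', hbb']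
    exact hmτ _ ((S.pA_bij e).mapsTo hb)
  refine ⟨e', ht, τ, hτ, hπ.symm, fun b hb => ?_, fun b' hb' => ?_⟩
  · obtain ⟨b', hb', hbb'⟩ := hY.surjOn ((hm _).2 ((S.pA_bij e).mapsTo hb))
    exact ⟨b', hb', key b b' hb hb' hbb'⟩
  · obtain ⟨b, hb, hbb'⟩ := (S.pA_bij e).surjOn
      ((hm (m.symm (S'.pA b'))).1 (by simpa using hY.mapsTo hb'))
    exact ⟨b, hb, key b b' hb hb' (by simp [hbb'])⟩

end Matched

/-! ## Extending local maps over the tree -/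

section Lift

variable (S : Scaffolding 𝒢 V A) (S' : Scaffolding 𝒢 V' A')

/-- A partial function from the vertices of `T_Σ` to pairs of a vertex of `T_Σ'` and a local map,
defined on a geodesically closed set, for which the local maps at the ends of every arc match. -/
structure IsPartialLift (Z : Set (Quotient S.rel × Quotient S'.rel × Equiv.Perm 𝒳)) : Prop where
  functional : ∀ z ∈ Z, ∀ w ∈ Z, z.1 = w.1 → z = w
  π_eq : ∀ z ∈ Z, S.π.onV z.1 = S'.π.onV z.2.1
  mem : ∀ z ∈ Z, z.2.2 ∈ 𝒢.G (S.π.onV z.1)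
  arc : ∀ e, ∀ z ∈ Z, ∀ w ∈ Z, S.tree.t e = z.1 → S.tree.o e = w.1 →
    ∃ e', S'.tree.t e' = z.2.1 ∧ S'.tree.o e' = w.2.1 ∧ Matched S S' z.2.2 w.2.2 e e'
  support_subset : ∀ u ∈ Prod.fst '' Z, ∀ w ∈ Prod.fst '' Z, ∀ p : S.tree.underlying.Walk u w,
    p.IsPath → ∀ x ∈ p.support, x ∈ Prod.fst '' Z

variable {S S'}

/-- Every condition involves at most two elements, and these lie in a common member of the chain. -/
theorem IsPartialLift.sUnion {c : Set (Set (Quotient S.rel × Quotient S'.rel × Equiv.Perm 𝒳))}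
    (hc : ∀ Z ∈ c, IsPartialLift S S' Z) (hchain : IsChain (· ⊆ ·) c) :
    IsPartialLift S S' (⋃₀ c) := by
  have hdir : ∀ z ∈ ⋃₀ c, ∀ w ∈ ⋃₀ c, ∃ Z ∈ c, z ∈ Z ∧ w ∈ Z := by
    rintro z ⟨Z, hZ, hz⟩ w ⟨W, hW, hw⟩
    rcases hchain.total hZ hW with h | h
    · exact ⟨W, hW, h hz, hw⟩
    · exact ⟨Z, hZ, hz, h hw⟩
  refine ⟨fun z hz w hw => ?_, fun z ⟨Z, hZ, hz⟩ => (hc Z hZ).π_eq z hz,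
    fun z ⟨Z, hZ, hz⟩ => (hc Z hZ).mem z hz, fun e z hz w hw => ?_, ?_⟩
  · obtain ⟨Z, hZ, hz, hw⟩ := hdir z hz w hw
    exact (hc Z hZ).functional z hz w hw
  · obtain ⟨Z, hZ, hz, hw⟩ := hdir z hz w hw
    exact (hc Z hZ).arc e z hz w hw
  · rintro _ ⟨z, hz, rfl⟩ _ ⟨w, hw, rfl⟩ p hp x hx
    obtain ⟨Z, hZ, hz, hw⟩ := hdir z hz w hw
    exact Set.image_mono (Set.subset_sUnion_of_mem hZ)
      ((hc Z hZ).support_subset _ ⟨z, hz, rfl⟩ _ ⟨w, hw, rfl⟩ p hp x hx)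

/-- A set of vertices of a tree that contains the geodesics between its elements remains so when
a neighbour of an element is added. -/
theorem path_support_subset_insert {W : Type*} {G : SimpleGraph W} (hG : G.IsAcyclic)
    (hconn : G.Connected) {D : Set W}
    (hD : ∀ u ∈ D, ∀ w ∈ D, ∀ p : G.Walk u w, p.IsPath → ∀ x ∈ p.support, x ∈ D)
    {x u : W} (hx : x ∉ D) (hu : u ∈ D) (h : G.Adj x u) :
    ∀ v ∈ insert x D, ∀ w ∈ insert x D, ∀ p : G.Walk v w, p.IsPath →
      ∀ y ∈ p.support, y ∈ insert x D := by
  classical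
  have key : ∀ w ∈ D, ∀ p : G.Walk x w, p.IsPath → ∀ y ∈ p.support, y ∈ insert x D := by
    intro w hw p hp y hy
    obtain ⟨q, hq⟩ := (hconn.preconnected u w).exists_isPath
    have hxq : x ∉ q.support := fun hxq => hx (hD u hu w hw q hq x hxq)
    -- Paths are unique in a forest, so `p` is the edge to `u` followed by a path inside `D`.
    have : p = q.cons h := congrArg Subtype.val
      ((hG.subsingleton_path x w).elim ⟨p, hp⟩ ⟨q.cons h, hq.cons hxq⟩)
    rw [this, SimpleGraph.Walk.support_cons, List.mem_cons] at hy
    exact hy.imp id (hD u hu w hw q hq y)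
  rintro v (rfl | hv) w (rfl | hw) p hp y hy
  · rw [SimpleGraph.Walk.isPath_iff_nil, ← SimpleGraph.Walk.eq_nil_iff_nil] at hp
    subst hp
    simp at hy
    exact Or.inl hy
  · exact key w hw p hp y hy
  · exact key v hv p.reverse hp.reverse y (by simpa using hy)
  · exact Or.inr (hD v hv w hw p hp y hy)

/-- Two different neighbours in `D` would be joined by a path of length two through `x`, forcing `x`
into `D`. -/
theorem eq_of_adj_of_adj {W : Type*} {G : SimpleGraph W} {D : Set W}
    (hD : ∀ u ∈ D, ∀ w ∈ D, ∀ p : G.Walk u w, p.IsPath → ∀ x ∈ p.support, x ∈ D)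
    {x u w : W} (hx : x ∉ D) (hu : u ∈ D) (hw : w ∈ D) (hxu : G.Adj x u) (hxw : G.Adj x w) :
    w = u := by
  by_contra hne
  refine hx (hD u hu w hw ((SimpleGraph.Walk.nil.cons hxw).cons hxu.symm) ?_ x (by simp))
  simp [SimpleGraph.Walk.cons_isPath_iff, hxw.ne, hxu.ne', Ne.symm hne]

/-- The local map is carried across `e` by `exists_matched`. It needs no further compatibility: by
geodesic closedness, `e` and its reverse are the only arcs between the new vertex and the old
domain. -/
theorem IsPartialLift.exists_insert {Z : Set (Quotient S.rel × Quotient S'.rel × Equiv.Perm 𝒳)}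
    (hZ : IsPartialLift S S' Z) {e : Quotient (S.graph.arcRel S.rel)}
    (ht : S.tree.t e ∈ Prod.fst '' Z) (ho : S.tree.o e ∉ Prod.fst '' Z) :
    ∃ z : Quotient S.rel × Quotient S'.rel × Equiv.Perm 𝒳, z.1 = S.tree.o e ∧
      IsPartialLift S S' (insert z Z) := by
  have hadj := adj_of_arc e
  obtain ⟨⟨u, u', σ⟩, hu, hue⟩ := id ht
  dsimp only at hue
  subst hue
  obtain ⟨e', rfl, τ, hτ, hm⟩ := exists_matched e (hZ.π_eq _ hu) (hZ.mem _ hu)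
  have hne : ∀ w ∈ Z, w.1 ≠ S.tree.o e := fun w hw h => ho ⟨w, hw, h⟩
  have hπ : S.π.onV (S.tree.o e) = S'.π.onV (S'.tree.o e') := by
    rw [S.π.map_o, S'.π.map_o, hm.π_eq]
  refine ⟨(S.tree.o e, S'.tree.o e', τ), rfl, ?_, ?_, ?_, ?_, ?_⟩
  · rintro z (rfl | hz) w (rfl | hw) h
    · rfl
    · exact absurd h.symm (hne w hw)
    · exact absurd h (hne z hz)
    · exact hZ.functional z hz w hw h
  · rintro z (rfl | hz)
    · exact hπ
    · exact hZ.π_eq z hz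
  · rintro z (rfl | hz)
    · exact hτ
    · exact hZ.mem z hz
  · rintro e₂ z (rfl | hz) w (rfl | hw) h2t h2o
    · exact absurd (h2o.trans h2t.symm) (S.isTree.1.1 e₂)
    · have hwu : w.1 = S.tree.t e := by
        refine eq_of_adj_of_adj hZ.support_subset ho ht ⟨w, hw, rfl⟩ hadj ?_
        have := (adj_of_arc e₂).symm
        rwa [h2t, h2o] at this
      obtain rfl := hZ.functional _ hu _ hw hwu.symm
      have : e₂ = S.tree.rev e := S.isTree.1.2 _ _
        (by rw [h2o, ← S.tree.t_eq_o_rev]) (by rw [h2t, ← S.tree.o_eq_t_rev])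
      subst this
      exact ⟨S'.tree.rev e', (S'.tree.o_eq_t_rev e').symm, (S'.tree.t_eq_o_rev e').symm, hm.rev⟩
    · have hwu : z.1 = S.tree.t e := by
        refine eq_of_adj_of_adj hZ.support_subset ho ht ⟨z, hz, rfl⟩ hadj ?_
        have := adj_of_arc e₂
        rwa [h2t, h2o] at this
      obtain rfl := hZ.functional _ hu _ hz hwu.symm
      have : e₂ = e := S.isTree.1.2 _ _ h2o h2t
      subst this
      exact ⟨e', rfl, rfl, hm⟩
    · exact hZ.arc e₂ z hz w hw h2t h2o
  · rw [Set.image_insert_eq]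
    exact path_support_subset_insert S.isTree.2.2 S.isTree.2.1 hZ.support_subset ho ht hadj

variable (S S') in
/-- A map of vertices between the trees, with local maps in the vertex groups which match along
every arc. -/
structure IsLift (φ : Quotient S.rel → Quotient S'.rel) (σ : Quotient S.rel → Equiv.Perm 𝒳) :
    Prop where
  π_eq : ∀ u, S.π.onV u = S'.π.onV (φ u)
  mem : ∀ u, σ u ∈ 𝒢.G (S.π.onV u)
  arc : ∀ e, ∃ e', S'.tree.t e' = φ (S.tree.t e) ∧ S'.tree.o e' = φ (S.tree.o e) ∧
    Matched S S' (σ (S.tree.t e)) (σ (S.tree.o e)) e e'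

/-- If a maximal partial lift missed a vertex, connectedness would give an edge leaving its domain,
and the lift could be extended across that edge. -/
theorem IsPartialLift.exists_isLift
    {Z : Set (Quotient S.rel × Quotient S'.rel × Equiv.Perm 𝒳)} (hZ : IsPartialLift S S' Z)
    (hne : Z.Nonempty) :
    ∃ φ σ, IsLift S S' φ σ ∧ ∀ z ∈ Z, φ z.1 = z.2.1 ∧ σ z.1 = z.2.2 := by
  obtain ⟨M, hZM, hM⟩ := zorn_subset_nonempty {Z | IsPartialLift S S' Z}
    (fun c hc hchain _ => ⟨⋃₀ c, IsPartialLift.sUnion hc hchain,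
      fun s hs => Set.subset_sUnion_of_mem hs⟩) Z hZ
  have hML : IsPartialLift S S' M := hM.prop
  have hfull : ∀ u, u ∈ Prod.fst '' M := by
    intro u
    by_contra hu
    obtain ⟨z, hz⟩ := hne
    obtain ⟨p⟩ := S.isTree.2.1.preconnected z.1 u
    obtain ⟨d, -, hd1, hd2⟩ := p.exists_boundary_dart (Prod.fst '' M) ⟨z, hZM hz, rfl⟩ hu
    obtain ⟨e, heo, het⟩ := exists_arc_of_adj d.adj.symm
    rw [← het] at hd1
    rw [← heo] at hd2
    obtain ⟨w, hw, hwM⟩ := hML.exists_insert hd1 hd2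
    have hwmem : w ∈ M := hM.le_of_ge hwM (Set.subset_insert w M) (Set.mem_insert w M)
    exact hd2 ⟨w, hwmem, hw⟩
  choose g hgM hg using hfull
  refine ⟨fun u => (g u).2.1, fun u => (g u).2.2, ⟨fun u => ?_, fun u => ?_, fun e => ?_⟩,
    fun z hz => ?_⟩
  · have := hML.π_eq _ (hgM u)
    rwa [hg] at this
  · have := hML.mem _ (hgM u)
    rwa [hg] at this
  · exact hML.arc e _ (hgM _) _ (hgM _) (hg _).symm (hg _).symm
  · have := hML.functional _ (hgM z.1) _ (hZM hz) (hg _)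
    simp [this]

variable {φ : Quotient S.rel → Quotient S'.rel} {σ : Quotient S.rel → Equiv.Perm 𝒳}

theorem IsLift.apply_mem_iff (h : IsLift S S' φ σ) (u : Quotient S.rel) (z : 𝒳) :
    σ u z ∈ 𝒢.X (S.π.onV u) ↔ z ∈ 𝒢.X (S.π.onV u) :=
  (𝒢.vertexAction _).apply_mem_iff (h.mem u) z

/-- Local surjectivity: the adhesion set of `e'` is pulled back by `σ u` to that of an arc `e`. The
arc matched with `e` then has the adhesion set of `e'`, so it is `e'` by uniqueness. -/
theorem IsLift.exists_arc (h : IsLift S S' φ σ) {u : Quotient S.rel}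
    {e' : Quotient (S'.graph.arcRel S'.rel)} (he' : S'.tree.t e' = φ u) :
    ∃ e, S.tree.t e = u ∧ S'.tree.o e' = φ (S.tree.o e) ∧
      Matched S S' (σ u) (σ (S.tree.o e)) e e' := by
  have hu : 𝒢.base.t (S'.π.onA e') = S.π.onV u := by rw [← S'.π.map_t, he', h.π_eq]
  obtain ⟨e, hπ, rfl, hB⟩ := exists_arc_termImage_eq hu
    (isAdhesionSet_image (S'.isAdhesionSet_termImage e') (hu ▸ inv_mem (h.mem u)))
  obtain ⟨e₂, ht, ho, hm⟩ := h.arc e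
  have : e₂ = e' := by
    refine arc_eq_of_termImage_eq (ht.trans he'.symm) (hm.π_eq.symm.trans hπ) ?_
    rw [hm.termImage_eq, hB, Set.image_image]
    simp
  subst this
  exact ⟨e, rfl, ho, hm⟩

/-- By `exists_arc` the range of `φ` is closed under taking neighbours, and the target tree is
connected. -/
theorem IsLift.surjective (h : IsLift S S' φ σ) : Function.Surjective φ := by
  intro u'
  by_contra hu'
  obtain ⟨u⟩ := S.isTree.2.1.nonempty
  obtain ⟨p⟩ := S'.isTree.2.1.preconnected (φ u) u'
  obtain ⟨d, -, ⟨w, hw⟩, hd⟩ := p.exists_boundary_dart (Set.range φ) ⟨u, rfl⟩ hu'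
  obtain ⟨e', ho, ht⟩ := exists_arc_of_adj d.adj.symm
  obtain ⟨e, -, heo, -⟩ := h.exists_arc (ht.trans hw.symm)
  exact hd ⟨_, heo.symm.trans ho⟩

theorem IsLift.map_adj (h : IsLift S S' φ σ) {u w : Quotient S.rel}
    (huw : S.tree.underlying.Adj u w) : S'.tree.underlying.Adj (φ u) (φ w) := by
  obtain ⟨e, rfl, rfl⟩ := exists_arc_of_adj huw
  obtain ⟨e', ht, ho, -⟩ := h.arc e
  rw [← ht, ← ho]
  exact adj_of_arc e'

/-- Local injectivity: arcs into `v` with the same image arc have adhesion sets with the same `σ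
v`-image, hence equal ones. -/
theorem IsLift.eq_of_adj (h : IsLift S S' φ σ) {u v w : Quotient S.rel}
    (hu : S.tree.underlying.Adj u v) (hw : S.tree.underlying.Adj w v) (huw : φ u = φ w) :
    u = w := by
  obtain ⟨e, rfl, rfl⟩ := exists_arc_of_adj hu
  obtain ⟨e₂, rfl, ht₂⟩ := exists_arc_of_adj hw
  obtain ⟨e', ht', ho', hm⟩ := h.arc e
  obtain ⟨e₂', ht₂', ho₂', hm₂⟩ := h.arc e₂
  rw [ht₂] at ht₂' hm₂
  have : e' = e₂' := S'.isTree.1.2 _ _ (by rw [ho', ho₂', huw]) (by rw [ht', ht₂'])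
  subst this
  have hB := hm.termImage_eq.symm.trans hm₂.termImage_eq
  rw [arc_eq_of_termImage_eq ht₂.symm (hm.π_eq.trans hm₂.π_eq.symm)
    ((σ _).injective.image_injective hB)]

/-- A locally injective map sends paths to walks without backtracking, and in a forest these are
paths. A path joining two vertices with equal images is thus sent to a closed path, which has length
zero. -/
theorem IsLift.injective (h : IsLift S S' φ σ) : Function.Injective φ := by
  intro u w huw
  let F : S.tree.underlying →g S'.tree.underlying := ⟨φ, h.map_adj⟩
  have key : ∀ {u w} (p : S.tree.underlying.Walk u w), p.IsPath →
      List.IsChain (· ≠ ·) (p.map F).edges := by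
    intro u w p hp
    induction p with
    | nil => simp
    | cons hadj q ih =>
      have hq := ih hp.of_cons
      cases q with
      | nil => simp
      | cons hadj' q =>
        rw [SimpleGraph.Walk.map_cons, SimpleGraph.Walk.edges_cons, SimpleGraph.Walk.map_cons,
          SimpleGraph.Walk.edges_cons]
        rw [SimpleGraph.Walk.map_cons, SimpleGraph.Walk.edges_cons] at hq
        refine List.IsChain.cons_cons (fun heq => ?_) hq
        -- Equal consecutive edges in the image have equal outer ends, so by local injectivity the
        -- path itself would turn back.
        rw [Sym2.eq_swap, Sym2.congr_right] at heq
        have := h.eq_of_adj hadj hadj'.symm heq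
        subst this
        simp [SimpleGraph.Walk.cons_isPath_iff] at hp
  classical
  obtain ⟨p, hp⟩ := (S.isTree.2.1.preconnected u w).exists_isPath
  have hpath := (S'.isTree.2.2.isPath_iff_isChain (p.map F)).2 (key p hp)
  have hlen : ((p.map F).copy rfl huw.symm).length = 0 := by
    have : ((p.map F).copy rfl huw.symm).IsPath := by
      simpa only [SimpleGraph.Walk.isPath_copy] using hpath
    exact SimpleGraph.Walk.length_eq_zero_iff.2 (SimpleGraph.Walk.isPath_iff_nil.1 this)
  simp only [SimpleGraph.Walk.length_copy, SimpleGraph.Walk.length_map] at hlen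
  exact SimpleGraph.Walk.eq_of_length_eq_zero hlen

end Lift

/-! ## Scaffolding isomorphisms from local maps -/

section Construction

variable {S : Scaffolding 𝒢 V A} {S' : Scaffolding 𝒢 V' A'}
variable {φ : Quotient S.rel → Quotient S'.rel} {σ : Quotient S.rel → Equiv.Perm 𝒳}

theorem IsLift.exists_onV (h : IsLift S S' φ σ) :
    ∃ f : V ≃ V', ∀ x, S'.bunV (f x) = φ (S.bunV x) ∧
      S'.pV (f x) = σ (S.bunV x) (S.pV x) := by
  have hex : ∀ x, ∃ x', S'.bunV x' = φ (S.bunV x) ∧ S'.pV x' = σ (S.bunV x) (S.pV x) := by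
    intro x
    have hx := (h.apply_mem_iff _ _).2 (S.pV_mem x)
    rw [h.π_eq] at hx
    exact (S'.pV_bij (φ (S.bunV x))).surjOn hx
  choose f hf using hex
  refine ⟨Equiv.ofBijective f ⟨fun x y hxy => ?_, fun x' => ?_⟩, hf⟩
  · have hb : S.bunV x = S.bunV y := h.injective (by rw [← (hf x).1, ← (hf y).1, hxy])
    refine vertex_ext hb ((σ (S.bunV x)).injective ?_)
    rw [← (hf x).2, hxy, (hf y).2, hb]
  · obtain ⟨u, hu⟩ := h.surjective (S'.bunV x')
    have hx' := S'.pV_mem x'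
    rw [← hu, ← h.π_eq] at hx'
    obtain ⟨x, hx, hp⟩ := (S.pV_bij u).surjOn
      ((h.apply_mem_iff u ((σ u).symm (S'.pV x'))).1 (by simpa using hx'))
    change S.bunV x = u at hx
    subst hx
    exact ⟨x, vertex_ext ((hf x).1.trans hu) (by rw [(hf x).2, hp]; simp)⟩

theorem Matched.apply_ends {e : Quotient (S.graph.arcRel S.rel)}
    {e' : Quotient (S'.graph.arcRel S'.rel)} (ht' : S'.tree.t e' = φ (S.tree.t e))
    (ho' : S'.tree.o e' = φ (S.tree.o e)) {f : V → V'}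
    (hf : ∀ x, S'.bunV (f x) = φ (S.bunV x) ∧ S'.pV (f x) = σ (S.bunV x) (S.pV x))
    {b : A} {b' : A'} (hb : S.bunA b = e) (hb' : S'.bunA b' = e')
    (ht : S'.pV (S'.graph.t b') = σ (S.tree.t e) (S.pV (S.graph.t b)))
    (ho : S'.pV (S'.graph.o b') = σ (S.tree.o e) (S.pV (S.graph.o b))) :
    f (S.graph.o b) = S'.graph.o b' ∧ f (S.graph.t b) = S'.graph.t b' := by
  subst hb hb'
  exact ⟨vertex_ext ((hf _).1.trans ho'.symm) ((hf _).2.trans ho.symm),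
    vertex_ext ((hf _).1.trans ht'.symm) ((hf _).2.trans ht.symm)⟩

/-- Since arcs are determined by their ends, it suffices to find for each arc one with the right
ends; bijectivity and compatibility with reversal then follow from the vertex map. -/
theorem IsLift.exists_scIso (h : IsLift S S' φ σ) :
    ∃ F : ScIso S S', ∀ x, S'.bunV (F.onV x) = φ (S.bunV x) ∧
      S'.pV (F.onV x) = σ (S.bunV x) (S.pV x) := by
  obtain ⟨f, hf⟩ := h.exists_onV
  have hex : ∀ a, ∃ a', (f (S.graph.o a) = S'.graph.o a' ∧ f (S.graph.t a) = S'.graph.t a') ∧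
      S.π.onA (S.bunA a) = S'.π.onA (S'.bunA a') := by
    intro a
    obtain ⟨e', ht', ho', hm⟩ := h.arc (S.bunA a)
    obtain ⟨a', ha', ht, ho⟩ := hm.forth a rfl
    exact ⟨a', Matched.apply_ends ht' ho' hf rfl ha' ht ho, ha' ▸ hm.π_eq⟩
  choose g hg hgπ using hex
  have hginj : Function.Injective g := fun a b hab =>
    arc_ext (f.injective (by rw [(hg a).1, hab, (hg b).1]))
      (f.injective (by rw [(hg a).2, hab, (hg b).2]))
  have hgsurj : Function.Surjective g := by
    intro a'
    obtain ⟨u, hu⟩ := h.surjective (S'.tree.t (S'.bunA a'))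
    obtain ⟨e, rfl, ho', hm⟩ := h.exists_arc hu.symm
    obtain ⟨a, ha, ht, ho⟩ := hm.back a' rfl
    obtain ⟨h1, h2⟩ := Matched.apply_ends hu.symm ho' hf ha rfl ht ho
    exact ⟨a, arc_ext ((hg a).1.symm.trans h1) ((hg a).2.symm.trans h2)⟩
  have hrel : ∀ x y, S.rel x y ↔ S'.rel (f x) (f y) := fun x y => by
    rw [← Quotient.eq (r := S.rel), ← Quotient.eq (r := S'.rel)]
    change S.bunV x = S.bunV y ↔ S'.bunV (f x) = S'.bunV (f y)
    rw [(hf x).1, (hf y).1, h.injective.eq_iff]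
  refine ⟨{
    onV := f
    onA := Equiv.ofBijective g ⟨hginj, hgsurj⟩
    map_o := fun a => (hg a).1
    map_t := fun a => (hg a).2
    map_rev := fun a => arc_ext (S := S') ?_ ?_
    relV_iff := hrel
    relA_iff := fun a b => ?_
    π_onV := fun x => (h.π_eq _).trans (congrArg _ (hf x).1.symm)
    π_onA := hgπ }, hf⟩
  · change S'.graph.o (g _) = S'.graph.o (S'.graph.rev (g a))
    rw [← (hg _).1, ← S.graph.t_eq_o_rev, (hg a).2, S'.graph.t_eq_o_rev]
  · change S'.graph.t (g _) = S'.graph.t (S'.graph.rev (g a))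
    rw [← (hg _).2, ← S.graph.o_eq_t_rev, (hg a).1, S'.graph.o_eq_t_rev]
  · change _ ∧ _ ↔ S'.rel (S'.graph.o (g a)) (S'.graph.o (g b)) ∧
      S'.rel (S'.graph.t (g a)) (S'.graph.t (g b))
    rw [hrel, hrel, (hg a).1, (hg a).2, (hg b).1, (hg b).2]

/-- A partial lift is induced by an acceptable scaffolding isomorphism. -/
theorem IsPartialLift.exists_scIso
    {Z : Set (Quotient S.rel × Quotient S'.rel × Equiv.Perm 𝒳)} (hZ : IsPartialLift S S' Z)
    (hne : Z.Nonempty) :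
    ∃ F : ScIso S S', F.Acceptable ∧
      ∀ z ∈ Z, F.tilde z.1 = z.2.1 ∧ F.IsLocalMap z.1 z.2.2 := by
  obtain ⟨φ, σ, h, hφσ⟩ := hZ.exists_isLift hne
  obtain ⟨F, hF⟩ := h.exists_scIso
  have hloc : ∀ u, F.IsLocalMap u (σ u) := fun u =>
    ⟨(𝒢.vertexAction _).fixes_compl _ (h.mem u), by rintro x rfl; exact (hF x).2.symm⟩
  refine ⟨F, fun u => ⟨σ u, h.mem u, hloc u⟩, fun z hz => ?_⟩
  obtain ⟨h1, h2⟩ := hφσ z hz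
  rw [← h1, ← h2]
  refine ⟨?_, hloc _⟩
  induction z.1 using Quotient.inductionOn with
  | h x => exact (hF x).1

theorem isPartialLift_singleton {v : Quotient S.rel} {v' : Quotient S'.rel}
    (hv : S.π.onV v = S'.π.onV v') {f₀ : Equiv.Perm 𝒳} (hf₀ : f₀ ∈ 𝒢.G (S.π.onV v)) :
    IsPartialLift S S' {(v, v', f₀)} where
  functional := by
    rintro z rfl w rfl -
    rfl
  π_eq := by
    rintro z rfl
    exact hv
  mem := by
    rintro z rfl
    exact hf₀
  arc := by
    rintro e z rfl w rfl ht ho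
    exact absurd (ho.trans ht.symm) (S.isTree.1.1 e)
  support_subset := by
    simp only [Set.image_singleton]
    rintro u rfl w rfl p hp x hx
    rw [SimpleGraph.Walk.isPath_iff_nil, ← SimpleGraph.Walk.eq_nil_iff_nil] at hp
    subst hp
    simpa using hx

/-- A scaffolding has vertices over every vertex of the base graph. -/
theorem π_onV_surjective (S : Scaffolding 𝒢 V A) : Function.Surjective S.π.onV := by
  intro v
  by_contra hv
  obtain ⟨u⟩ := S.isTree.2.1.nonempty
  obtain ⟨p⟩ := 𝒢.connected.preconnected (S.π.onV u) v
  obtain ⟨d, -, ⟨w, hw⟩, hd⟩ := p.exists_boundary_dart (Set.range S.π.onV) ⟨u, rfl⟩ hv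
  obtain ⟨b, hbt, hbo⟩ : ∃ b, 𝒢.base.t b = d.fst ∧ 𝒢.base.o b = d.snd := by
    obtain ⟨-, a, ⟨ho, ht⟩ | ⟨ho, ht⟩⟩ := d.adj
    · exact ⟨𝒢.base.rev a, by rw [← 𝒢.base.o_eq_t_rev, ho], by rw [← 𝒢.base.t_eq_o_rev, ht]⟩
    · exact ⟨a, ht, ho⟩
  obtain ⟨e, he, -, -⟩ := exists_arc_termImage_eq (hbt.trans hw.symm)
    (show 𝒢.IsAdhesionSet b _ from ⟨1, one_mem _, rfl⟩)
  exact hd ⟨S.tree.o e, by rw [S.π.map_o, he, hbo]⟩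

end Construction

/-! ## Partial scaffolding isomorphisms -/

section Partial

variable {S : Scaffolding 𝒢 V A} {S' : Scaffolding 𝒢 V' A'}
variable {R : S.tree.Subgraph} {R' : S'.tree.Subgraph}

theorem path_support_subset_of_isSubtree (hR : R.IsSubtree) {u w : Quotient S.rel}
    (hu : u ∈ R.verts) (hw : w ∈ R.verts) {p : S.tree.underlying.Walk u w} (hp : p.IsPath)
    {x : Quotient S.rel} (hx : x ∈ p.support) : x ∈ R.verts := by
  classical
  let ι : R.coe.underlying →g S.tree.underlying :=
    ⟨Subtype.val, fun {a b} hab => ⟨fun h => hab.1 (Subtype.ext h), by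
      obtain ⟨c, hc⟩ := hab.2
      exact ⟨c, hc.imp (And.imp (congrArg Subtype.val) (congrArg Subtype.val))
        (And.imp (congrArg Subtype.val) (congrArg Subtype.val))⟩⟩⟩
  have hι : Function.Injective ι := Subtype.val_injective
  obtain ⟨q, hq⟩ := (hR.2.1.preconnected ⟨u, hu⟩ ⟨w, hw⟩).exists_isPath
  -- The path inside `R` is also the only path in the whole tree.
  have hpq : p = q.map ι := congrArg Subtype.val
    ((S.isTree.2.2.subsingleton_path u w).elim ⟨p, hp⟩
      ⟨q.map ι, SimpleGraph.Walk.IsPath.map hι hq⟩)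
  rw [hpq, SimpleGraph.Walk.support_map, List.mem_map] at hx
  obtain ⟨y, -, rfl⟩ := hx
  exact y.2

/-- The vertices of `R` with their images and local maps under a partial scaffolding
isomorphism. -/
def PartialScIso.graphOfLocalMaps (f : PartialScIso S S' R R') :
    Set (Quotient S.rel × Quotient S'.rel × Equiv.Perm 𝒳) :=
  {z | z.1 ∈ R.verts ∧ z.2.2 ∈ 𝒢.G (S.π.onV z.1) ∧ f.IsLocalMap z.1 z.2.2 ∧
    ∀ x : (S.part R).verts, S.bunV x = z.1 → S'.bunV (f.onV x) = z.2.1}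

theorem PartialScIso.exists_mem_graphOfLocalMaps {f : PartialScIso S S' R R'} (hf : f.Acceptable)
    {u : Quotient S.rel} (hu : u ∈ R.verts) : ∃ z ∈ f.graphOfLocalMaps, z.1 = u := by
  obtain ⟨σ, hσ, hloc⟩ := hf u hu
  induction u using Quotient.inductionOn with
  | h x =>
    exact ⟨(S.bunV x, S'.bunV (f.onV ⟨x, hu⟩), σ), ⟨hu, hσ, hloc, fun y hy =>
      Quotient.sound ((f.relV_iff y ⟨x, hu⟩).1 (Quotient.exact hy))⟩, rfl⟩

theorem PartialScIso.fst_image_graphOfLocalMaps {f : PartialScIso S S' R R'}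
    (hf : f.Acceptable) : Prod.fst '' f.graphOfLocalMaps = R.verts := by
  ext u
  constructor
  · rintro ⟨z, hz, rfl⟩
    exact hz.1
  · exact fun hu => f.exists_mem_graphOfLocalMaps hf hu

/-- An arc equivalent to one over `R` again lies over `R`, and likewise for `R'`. So `f` is defined
on the whole bundle of `a` and maps it onto the bundle of its image. -/
theorem PartialScIso.matched {f : PartialScIso S S' R R'} (a : (S.part R).arcs)
    {σ τ : Equiv.Perm 𝒳} (hσ : f.IsLocalMap (S.tree.t (S.bunA a)) σ)
    (hτ : f.IsLocalMap (S.tree.o (S.bunA a)) τ) :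
    Matched S S' σ τ (S.bunA a) (S'.bunA (f.onA a)) := by
  have key : ∀ b : (S.part R).arcs, S.bunA b = S.bunA a →
      S'.pV (S'.graph.t (f.onA b)) = σ (S.pV (S.graph.t b)) ∧
      S'.pV (S'.graph.o (f.onA b)) = τ (S.pV (S.graph.o b)) := by
    intro b hb
    have ht := hσ.2 ((S.part R).coe.t b) (congrArg S.tree.t hb)
    have ho := hτ.2 ((S.part R).coe.o b) (congrArg S.tree.o hb)
    rw [f.map_t] at ht
    rw [f.map_o] at ho
    exact ⟨ht.symm, ho.symm⟩
  refine ⟨f.π_onA a, fun b hb => ?_, fun b' hb' => ?_⟩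
  · have hmem : b ∈ (S.part R).arcs := by
      have h1 : S.bunV (S.graph.o b) = S.bunV (S.graph.o a) := congrArg S.tree.o hb
      have h2 : S.bunV (S.graph.t b) = S.bunV (S.graph.t a) := congrArg S.tree.t hb
      have := a.2
      exact ⟨Set.mem_of_eq_of_mem (s := R.verts) h1 this.1,
        Set.mem_of_eq_of_mem (s := R.verts) h2 this.2⟩
    exact ⟨f.onA ⟨b, hmem⟩, Quotient.sound ((f.relA_iff ⟨b, hmem⟩ a).1 (Quotient.exact hb)),
      key ⟨b, hmem⟩ hb⟩
  · have hmem : b' ∈ (S'.part R').arcs := by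
      have h1 : S'.bunV (S'.graph.o b') = S'.bunV (S'.graph.o (f.onA a)) :=
        congrArg S'.tree.o hb'
      have h2 : S'.bunV (S'.graph.t b') = S'.bunV (S'.graph.t (f.onA a)) :=
        congrArg S'.tree.t hb'
      have := (f.onA a).2
      exact ⟨Set.mem_of_eq_of_mem (s := R'.verts) h1 this.1,
        Set.mem_of_eq_of_mem (s := R'.verts) h2 this.2⟩
    obtain ⟨b, hb⟩ := f.onA.surjective ⟨b', hmem⟩
    have hba : S.bunA b = S.bunA a := Quotient.sound ((f.relA_iff b a).2 (by
      rw [hb]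
      exact Quotient.exact hb'))
    refine ⟨b, hba, ?_⟩
    have := key b hba
    rwa [hb] at this

theorem PartialScIso.isPartialLift {f : PartialScIso S S' R R'} (hf : f.Acceptable)
    (hR : R.IsSubtree) : IsPartialLift S S' f.graphOfLocalMaps where
  functional := by
    rintro ⟨u, u', σ⟩ ⟨hu, -, hσ, hu'⟩ ⟨w, w', τ⟩ ⟨-, -, hτ, hw'⟩ h
    dsimp only at hu hσ hu' hτ hw' h
    subst h
    have h1 : u' = w' := by
      induction u using Quotient.inductionOn with
      | h x => exact (hu' ⟨x, hu⟩ rfl).symm.trans (hw' ⟨x, hu⟩ rfl)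
    -- The colours of the bundle exhaust `X(π(u))`, and outside this set both permutations are
    -- trivial.
    have h2 : σ = τ := by
      ext z
      by_cases hz : z ∈ 𝒢.X (S.π.onV u)
      · obtain ⟨x, hx, rfl⟩ := (S.pV_bij u).surjOn hz
        have hx' : S.bunV x = u := hx
        have hmem : x ∈ (S.part R).verts := Set.mem_of_eq_of_mem (s := R.verts) hx' hu
        rw [hσ.2 ⟨x, hmem⟩ hx, hτ.2 ⟨x, hmem⟩ hx]
      · rw [hσ.1 z hz, hτ.1 z hz]
    rw [h1, h2]
  π_eq := by
    rintro ⟨u, u', σ⟩ ⟨hu, -, -, hu'⟩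
    induction u using Quotient.inductionOn with
    | h x => exact (f.π_onV ⟨x, hu⟩).trans (congrArg _ (hu' ⟨x, hu⟩ rfl))
  mem := fun z hz => hz.2.1
  arc := by
    rintro e ⟨_, u', σ⟩ ⟨hu, -, hσ, hu'⟩ ⟨_, w', τ⟩ ⟨hw, -, hτ, hw'⟩ rfl rfl
    induction e using Quotient.inductionOn with
    | h b =>
      have hmem : b ∈ (S.part R).arcs := ⟨hw, hu⟩
      refine ⟨S'.bunA (f.onA ⟨b, hmem⟩), ?_, ?_, f.matched ⟨b, hmem⟩ hσ hτ⟩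
      · refine Eq.trans ?_ (hu' ((S.part R).coe.t ⟨b, hmem⟩) rfl)
        rw [f.map_t]
        rfl
      · refine Eq.trans ?_ (hw' ((S.part R).coe.o ⟨b, hmem⟩) rfl)
        rw [f.map_o]
        rfl
  support_subset := by
    rw [fst_image_graphOfLocalMaps hf]
    exact fun u hu w hw p hp x hx => path_support_subset_of_isSubtree hR hu hw hp hx

theorem PartialScIso.exists_extends {f : PartialScIso S S' R R'} (hf : f.Acceptable)
    (hR : R.IsSubtree) : ∃ F : ScIso S S', F.Acceptable ∧ F.Extends f := by
  obtain ⟨u, hu⟩ := hR.2.1.nonempty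
  obtain ⟨z, hz, -⟩ := f.exists_mem_graphOfLocalMaps hf hu
  obtain ⟨F, hF, hFZ⟩ := (f.isPartialLift hf hR).exists_scIso ⟨z, hz⟩
  have hV : ∀ x : (S.part R).verts, F.onV x = f.onV x := by
    intro x
    obtain ⟨⟨_, u', σ⟩, hz, rfl⟩ := f.exists_mem_graphOfLocalMaps hf x.2
    obtain ⟨h1, h2⟩ := hFZ _ hz
    -- `F` and `f` have the same local maps over `R`, so `F x` and `f x` agree in bundle and colour.
    exact vertex_ext (h1.trans (hz.2.2.2 x rfl).symm)
      ((h2.2 x rfl).symm.trans (hz.2.2.1.2 x rfl))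
  refine ⟨F, hF, hV, fun a => arc_ext (S := S') ?_ ?_⟩
  · rw [← F.map_o]
    exact (hV ((S.part R).coe.o a)).trans (congrArg Subtype.val (f.map_o a))
  · rw [← F.map_t]
    exact (hV ((S.part R).coe.t a)).trans (congrArg Subtype.val (f.map_t a))

end Partial

end Scaffolding

end GGA

theorem mainTheorem1 {VΔ AΔ 𝒳 𝒴 V A V' A' : Type*}
    (𝒢 : GGA.GraphOfGroupActions VΔ AΔ 𝒳 𝒴)
    (S : GGA.Scaffolding 𝒢 V A) (S' : GGA.Scaffolding 𝒢 V' A') :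
    (∀ (R : S.tree.Subgraph) (R' : S'.tree.Subgraph), R.IsSubtree → R'.IsSubtree →
      ∀ f : GGA.Scaffolding.PartialScIso S S' R R', f.Acceptable →
        ∃ F : GGA.Scaffolding.ScIso S S', F.Acceptable ∧ F.Extends f) ∧
    (∀ (v : Quotient S.rel) (v' : Quotient S'.rel), S.π.onV v = S'.π.onV v' →
      ∀ f₀ ∈ 𝒢.G (S.π.onV v),
        ∃ F : GGA.Scaffolding.ScIso S S', F.Acceptable ∧ F.tilde v = v' ∧ F.IsLocalMap v f₀) ∧
    (∃ F : GGA.Scaffolding.ScIso S S', F.Acceptable) := by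
  refine ⟨fun R R' hR _ f hf => f.exists_extends hf hR, fun v v' hv f₀ hf₀ => ?_, ?_⟩
  · obtain ⟨F, hF, hFZ⟩ := (GGA.Scaffolding.isPartialLift_singleton hv hf₀).exists_scIso
      (Set.singleton_nonempty _)
    exact ⟨F, hF, hFZ _ rfl⟩
  · obtain ⟨v⟩ := S.isTree.2.1.nonempty
    obtain ⟨v', hv'⟩ := S'.π_onV_surjective (S.π.onV v)
    obtain ⟨F, hF, -⟩ := (GGA.Scaffolding.isPartialLift_singleton hv'.symm
      (one_mem (𝒢.G (S.π.onV v)))).exists_scIso (Set.singleton_nonempty _)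
    exact ⟨F, hF⟩
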